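/- Let $E$ be an operator space, i.e. a complex Banach space with a fixed isometric linear embedding $E\subset B(H)$, $H$ a complex Hilbert space. Let $\overline E$ (resp. $\overline H$) denote $E$ (resp. $H$) with the conjugate complex multiplication, and for $x\in E$ let $\bar x$ be $x$ regarded as an element of $\overline E$; $\overline E\subset B(\overline H)$ is an operator space. For $w=\sum_i x_i\otimes\bar y_i$ in the algebraic tensor product $E\otimes\overline E$ let $\|w\|_{\min}$ be the norm of the operator $\sum_i x_i\otimes\bar y_i$ on the Hilbert space tensor product $H\otimes_2\overline H$. A bounded operator $u\colon E\to Y$ into a Banach space is called $(2,oh)$-summing if there is a constant $C\ge 0$ such that $$\sum_i\|u(x_i)\|^2\le C^2\Big\|\sum_i x_i\otimes\bar x_i\Big\|_{\min}$$ for all finite sequences $(x_i)$ in $E$; the smallest such $C$ is denoted $\pi_{2,oh}(u)$. A closed subspace $F\subset E$ is regarded as an operator space through $F\subset E\subset B(H)$. An element of $E\otimes\overline E$ is called positive if it is of the form $\sum_{i=1}^n x_i\otimes\bar x_i$ with $x_i\in E$. A linear form $\varphi$ on $E\otimes\overline E$ is called positive if $\varphi(x\otimes\bar x)\ge 0$ for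 all $x\in E$. Let $K(E)$ be the set of positive linear forms $\varphi$ on $E\otimes\overline E$ such that $\varphi(w)\le 1$ for every positive $w\in E\otimes\overline E$ with $\|w\|_{\min}\le 1$. **Proposition 1.** Let $E$ be an operator space, $F\subset E$ a closed subspace, $Y$ a complex Banach space, $u\colon F\to Y$ a bounded operator, and $C\ge 0$ a constant. The following are equivalent. (i) $u$ is $(2,oh)$-summing with $\pi_{2,oh}(u)\le C$. (ii) There is a $\varphi\in K(E)$ such that $\|u(x)\|^2\le C^2\varphi(x\otimes\bar x)$ for all $x\in F$. (iii) There is a bounded operator $\tilde u\colon E\to Y$ such that $\tilde u|_F=u$, $\tilde u$ is $(2,oh)$-summing, and $\pi_{2,oh}(\tilde u)\le C$. -/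

import Mathlib

open scoped TensorProduct ComplexOrder

noncomputable section

/-- The complex conjugate of a complex vector space: the same additive group (and the same norm),
with scalar multiplication `c • x̄ = (conj c • x)‾`. -/
def ConjSpace (E : Type*) : Type _ := E

namespace ConjSpace

variable {E H : Type*}

/-- The identity map `x ↦ x̄` from `E` to its conjugate. -/
def bar : E ≃ ConjSpace E := Equiv.refl E

instance [NormedAddCommGroup E] : NormedAddCommGroup (ConjSpace E) :=
  inferInstanceAs (NormedAddCommGroup E)

instance [NormedAddCommGroup E] [CompleteSpace E] : CompleteSpace (ConjSpace E) :=
  inferInstanceAs (CompleteSpace E)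

theorem bar_add [NormedAddCommGroup E] (x y : E) : bar (x + y) = bar x + bar y := rfl

theorem bar_symm_add [NormedAddCommGroup E] (x y : ConjSpace E) : bar.symm (x + y) = bar.symm x + bar.symm y := rfl

theorem norm_bar [NormedAddCommGroup E] (x : E) : ‖bar x‖ = ‖x‖ := rfl

theorem norm_bar_symm [NormedAddCommGroup E] (x : ConjSpace E) : ‖bar.symm x‖ = ‖x‖ := rfl

section Normed

variable [NormedAddCommGroup E] [NormedSpace ℂ E]

instance : Module ℂ (ConjSpace E) where
  smul c x := bar (starRingEnd ℂ c • bar.symm x)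
  one_smul x := by
    change starRingEnd ℂ 1 • bar.symm x = _
    rw [map_one, one_smul]; rfl
  mul_smul a b x := by
    change starRingEnd ℂ (a * b) • bar.symm x = starRingEnd ℂ a • starRingEnd ℂ b • bar.symm x
    rw [map_mul, mul_smul]
  smul_zero c := smul_zero (A := E) (starRingEnd ℂ c)
  smul_add c x y := smul_add (A := E) (starRingEnd ℂ c) (bar.symm x) (bar.symm y)
  add_smul a b x := by
    change starRingEnd ℂ (a + b) • bar.symm x
      = starRingEnd ℂ a • bar.symm x + starRingEnd ℂ b • bar.symm x
    rw [map_add, add_smul]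
  zero_smul x := by
    change starRingEnd ℂ 0 • bar.symm x = (0 : E)
    rw [map_zero, zero_smul]

theorem smul_bar (c : ℂ) (x : E) : c • bar x = bar (starRingEnd ℂ c • x) := rfl

theorem bar_symm_smul (c : ℂ) (x : ConjSpace E) :
    bar.symm (c • x) = starRingEnd ℂ c • bar.symm x := rfl

instance : NormedSpace ℂ (ConjSpace E) where
  norm_smul_le c x := by
    rw [← norm_bar_symm, bar_symm_smul, norm_smul, RCLike.norm_conj, norm_bar_symm]

end Normed

/-- The conjugate of a Hilbert space is a Hilbert space, with `⟪x̄, ȳ⟫ = ⟪y, x⟫`. -/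
instance [NormedAddCommGroup H] [InnerProductSpace ℂ H] : InnerProductSpace ℂ (ConjSpace H) where
  inner x y := inner ℂ (bar.symm y) (bar.symm x)
  norm_sq_eq_re_inner x := norm_sq_eq_re_inner (𝕜 := ℂ) (bar.symm x)
  conj_inner_symm x y := inner_conj_symm (𝕜 := ℂ) (bar.symm y) (bar.symm x)
  add_left x y z := inner_add_right (𝕜 := ℂ) (bar.symm z) (bar.symm x) (bar.symm y)
  smul_left x y c := by
    change inner ℂ (bar.symm y) (bar.symm (c • x)) = _
    rw [bar_symm_smul, inner_smul_right]

/-- A bounded operator `T` on `H`, viewed as the bounded operator `ξ̄ ↦ (T ξ)‾` on `H̄`. -/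
def op [NormedAddCommGroup H] [InnerProductSpace ℂ H] (T : H →L[ℂ] H) :
    ConjSpace H →L[ℂ] ConjSpace H :=
  LinearMap.mkContinuous
    { toFun := fun ξ => bar (T (bar.symm ξ))
      map_add' := fun ξ η => by rw [bar_symm_add, map_add, bar_add]
      map_smul' := fun c ξ => by
        rw [bar_symm_smul, map_smul, RingHom.id_apply, smul_bar] }
    ‖T‖ (fun ξ => T.le_opNorm (bar.symm ξ))

theorem op_apply [NormedAddCommGroup H] [InnerProductSpace ℂ H] (T : H →L[ℂ] H)
    (ξ : ConjSpace H) : op T ξ = bar (T (bar.symm ξ)) := rfl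

theorem norm_op [NormedAddCommGroup H] [InnerProductSpace ℂ H] (T : H →L[ℂ] H) :
    ‖op T‖ = ‖T‖ := by
  apply le_antisymm
  · exact ContinuousLinearMap.opNorm_le_bound _ (norm_nonneg T)
      (fun ξ => T.le_opNorm (bar.symm ξ))
  · exact ContinuousLinearMap.opNorm_le_bound _ (norm_nonneg (op T))
      (fun ξ => (op T).le_opNorm (bar ξ))

end ConjSpace

/-! An operator space is a Banach space `E` together with a linear isometry `ι : E →ₗᵢ[ℂ] B(H)`,
where `H` is a Hilbert space. -/

section OperatorSpace

variable {E G H K Y : Type*}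
  [NormedAddCommGroup E] [NormedSpace ℂ E] [NormedAddCommGroup G] [NormedSpace ℂ G]
  [NormedAddCommGroup H] [InnerProductSpace ℂ H] [NormedAddCommGroup K] [InnerProductSpace ℂ K]
  [NormedAddCommGroup Y] [NormedSpace ℂ Y]

/-- The conjugate operator space `Ē ⊆ B(H̄)` of `E ⊆ B(H)`. -/
def conjEmbedding (ι : E →ₗᵢ[ℂ] (H →L[ℂ] H)) :
    ConjSpace E →ₗᵢ[ℂ] (ConjSpace H →L[ℂ] ConjSpace H) where
  toFun x := ConjSpace.op (ι (ConjSpace.bar.symm x))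
  map_add' x y := by
    ext ξ
    simp only [ConjSpace.op_apply, ConjSpace.bar_symm_add, map_add, add_apply,
      ConjSpace.bar_add]
  map_smul' c x := by
    ext ξ
    simp only [ConjSpace.op_apply, ConjSpace.bar_symm_smul, map_smul, RingHom.id_apply,
      smul_apply, ConjSpace.smul_bar]
  norm_map' x := by
    change ‖ConjSpace.op (ι (ConjSpace.bar.symm x))‖ = ‖x‖
    rw [ConjSpace.norm_op, ι.norm_map, ConjSpace.norm_bar_symm]

/-- The operator on `H ⊗ K` defined by an element of `E ⊗ G`, for `E ⊆ B(H)` and `G ⊆ B(K)`;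
it sends `x ⊗ y` to `ι x ⊗ κ y`. Here `H ⊗ K` is the algebraic tensor product with the inner
product `⟪ξ ⊗ η, ξ' ⊗ η'⟫ = ⟪ξ, ξ'⟫ ⟪η, η'⟫`, a dense subspace of the Hilbert space tensor product. -/
def spatialMap (ι : E →ₗᵢ[ℂ] (H →L[ℂ] H)) (κ : G →ₗᵢ[ℂ] (K →L[ℂ] K)) :
    E ⊗[ℂ] G →ₗ[ℂ] (H ⊗[ℂ] K →L[ℂ] H ⊗[ℂ] K) :=
  TensorProduct.lift (LinearMap.mk₂ ℂ (fun x y => TensorProduct.mapL (ι x) (κ y))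
    (fun x x' y => by
      ext z; simp [TensorProduct.map_add_left])
    (fun c x y => by
      ext z; simp [TensorProduct.map_smul_left])
    (fun x y y' => by
      ext z; simp [TensorProduct.map_add_right])
    (fun c x y => by
      ext z; simp [TensorProduct.map_smul_right]))

/-- The minimal (spatial) tensor norm on `E ⊗ G`: the operator norm on `H ⊗ K`. (A bounded operator
on a dense subspace has the same norm as its extension to the completion.) -/
def minNorm (ι : E →ₗᵢ[ℂ] (H →L[ℂ] H)) (κ : G →ₗᵢ[ℂ] (K →L[ℂ] K)) (w : E ⊗[ℂ] G) : ℝ :=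
  ‖spatialMap ι κ w‖

/-- The element `∑ xᵢ ⊗ x̄ᵢ` of `E ⊗ Ē`. -/
def sumTmulBar {n : ℕ} (x : Fin n → E) : E ⊗[ℂ] ConjSpace E :=
  ∑ i, x i ⊗ₜ[ℂ] ConjSpace.bar (x i)

/-- `C` satisfies `∑ ‖u xᵢ‖² ≤ C² ‖∑ xᵢ ⊗ x̄ᵢ‖_min` for all finite sequences in `E`. -/
def IsTwoOHBound (ι : E →ₗᵢ[ℂ] (H →L[ℂ] H)) (u : E →L[ℂ] Y) (C : ℝ) : Prop :=
  ∀ (n : ℕ) (x : Fin n → E),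
    ∑ i, ‖u (x i)‖ ^ 2 ≤ C ^ 2 * minNorm ι (conjEmbedding ι) (sumTmulBar x)

/-- `u` is `(2,oh)`-summing. -/
def IsTwoOHSumming (ι : E →ₗᵢ[ℂ] (H →L[ℂ] H)) (u : E →L[ℂ] Y) : Prop :=
  ∃ C : ℝ, IsTwoOHBound ι u C

/-- `π_{2,oh}(u)`: the smallest nonnegative constant in the definition of `(2,oh)`-summing;
meaningful only for `(2,oh)`-summing `u`. -/
def pi2oh (ι : E →ₗᵢ[ℂ] (H →L[ℂ] H)) (u : E →L[ℂ] Y) : ℝ :=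
  sInf {C : ℝ | 0 ≤ C ∧ IsTwoOHBound ι u C}

/-- The positive elements of `E ⊗ Ē`. -/
def IsPositiveTensor (w : E ⊗[ℂ] ConjSpace E) : Prop :=
  ∃ (n : ℕ) (x : Fin n → E), w = sumTmulBar x

/-- A linear form `φ` on `E ⊗ Ē` is positive if every `φ (x ⊗ x̄)` is a nonnegative real number. -/
def IsPositiveForm (φ : E ⊗[ℂ] ConjSpace E →ₗ[ℂ] ℂ) : Prop :=
  ∀ x : E, 0 ≤ φ (x ⊗ₜ[ℂ] ConjSpace.bar x)

/-- `K(E)`: the positive linear forms on `E ⊗ Ē` that are at most `1` on the positive elements of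
minimal norm at most `1`. -/
def formsK (ι : E →ₗᵢ[ℂ] (H →L[ℂ] H)) : Set (E ⊗[ℂ] ConjSpace E →ₗ[ℂ] ℂ) :=
  {φ | IsPositiveForm φ ∧
    ∀ w, IsPositiveTensor w → minNorm ι (conjEmbedding ι) w ≤ 1 → (φ w).re ≤ 1}

end OperatorSpace

end

open scoped TensorProduct ComplexOrder

/-! The heart of the matter is (i) ⇒ (ii), a Hahn–Banach argument. Besides dominating `u`, the form
must be nonnegative on every `x ⊗ x̄` with `x` in `E`, so the minimal norm must not drop when a
positive tensor is added (`minNorm_le_minNorm_add`). To see this, identify `H ⊗ H̄` with the finite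
rank operators under the Hilbert–Schmidt norm: `∑ Aᵢ ⊗ Āᵢ` becomes the positive map `X ↦ ∑ Aᵢ X
Aᵢ*`. Polar decomposition and Cauchy–Schwarz show that its norm can be tested on positive `X`, where
an extra summand only increases the pairing. The sandwich theorem
`exists_linearMap_re_le_of_cone_le` then yields the form.

For (ii) ⇒ (iii), `φ` is a semi-inner product on `E`. Thus `u` factors through a subspace of a
Hilbert space, and orthogonal projection extends it with the same domination. For (iii) ⇒ (i), the
minimal norms over `F` and over `E` agree. -/

namespace ConjSpace

/-! ### Singular value and polar decompositions in `H ⊗ H̄` -/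

variable {H : Type*} [NormedAddCommGroup H] [InnerProductSpace ℂ H]

theorem inner_bar (x y : H) : inner ℂ (bar x) (bar y) = inner ℂ y x := rfl

theorem inner_tmul_bar (a b c d : H) :
    inner ℂ (a ⊗ₜ[ℂ] bar b) (c ⊗ₜ[ℂ] bar d) = inner ℂ a c * inner ℂ d b := by
  rw [TensorProduct.inner_tmul, inner_bar]

/-- Pythagoras; orthogonality of either one of the two families is enough. -/
theorem norm_sq_sum_tmul_bar {n : ℕ} (a b : Fin n → H)
    (h : ∀ i j, i ≠ j → inner ℂ (a i) (a j) * inner ℂ (b j) (b i) = 0) :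
    ‖∑ i, a i ⊗ₜ[ℂ] bar (b i)‖ ^ 2 = ∑ i, (‖a i‖ * ‖b i‖) ^ 2 := by
  rw [@norm_sq_eq_re_inner ℂ, sum_inner, map_sum]
  refine Finset.sum_congr rfl fun i _ => ?_
  rw [inner_sum, Finset.sum_eq_single i]
  · rw [inner_tmul_bar, inner_self_eq_norm_sq_to_K, inner_self_eq_norm_sq_to_K, mul_pow]
    norm_cast
  · intro j _ hj
    rw [inner_tmul_bar, h i j hj.symm]
  · simp

/-- Every tensor in `H ⊗ H̄` is `∑ aᵢ ⊗ b̄ᵢ` with `a` orthonormal and `b` orthogonal. -/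
theorem exists_orthogonal_decomposition [CompleteSpace H] (ξ : H ⊗[ℂ] ConjSpace H) :
    ∃ (n : ℕ) (a b : Fin n → H), Orthonormal ℂ a ∧
      (∀ i j, i ≠ j → inner ℂ (b i) (b j) = 0) ∧ ξ = ∑ i, a i ⊗ₜ[ℂ] bar (b i) := by
  obtain ⟨k, p, q, rfl⟩ : ∃ (k : ℕ) (p : Fin k → H) (q : Fin k → ConjSpace H),
      ξ = ∑ i, p i ⊗ₜ[ℂ] q i := by
    obtain ⟨S, rfl⟩ := TensorProduct.exists_finset ξ
    refine ⟨S.card, fun i => (S.equivFin.symm i).1.1, fun i => (S.equivFin.symm i).1.2, ?_⟩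
    rw [← Finset.sum_coe_sort S, ← Equiv.sum_comp S.equivFin.symm]
  let W : Submodule ℂ H := Submodule.span ℂ (Set.range p)
  have : FiniteDimensional ℂ W := FiniteDimensional.span_of_finite ℂ (Set.finite_range p)
  let p' : Fin k → W := fun i => ⟨p i, Submodule.subset_span ⟨i, rfl⟩⟩
  -- The tensor read as an operator on the span of its left legs. An eigenbasis of `b* b` is
  -- orthonormal and has orthogonal images under `b`: the singular value decomposition.
  let b : W →ₗ[ℂ] H := ∑ i, (innerₛₗ ℂ (p' i)).smulRight (bar.symm (q i))
  have hb : ∀ w : W, b w = ∑ i, (inner ℂ (p' i) w : ℂ) • bar.symm (q i) := fun w => by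
    simp [b]
  let B : W →L[ℂ] H := LinearMap.toContinuousLinearMap b
  let S : W →ₗ[ℂ] W := (ContinuousLinearMap.adjoint B ∘L B).toLinearMap
  have hS : S.IsSymmetric := fun x y => by
    simp [S, ContinuousLinearMap.adjoint_inner_left, ContinuousLinearMap.adjoint_inner_right]
  let e := hS.eigenvectorBasis rfl
  refine ⟨_, fun i => (e i : H), fun i => b (e i), ?_, ?_, ?_⟩
  · exact e.orthonormal.comp_linearIsometry W.subtypeₗᵢ
  · intro i j hij
    have h1 : inner ℂ (b (e i)) (b (e j)) = inner ℂ (e i) (S (e j)) := by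
      simp [S, ContinuousLinearMap.adjoint_inner_right, B]
    rw [h1, hS.apply_eigenvectorBasis, inner_smul_right, e.orthonormal.inner_eq_zero hij, mul_zero]
  · have hp : ∀ i, p i = ∑ j, (inner ℂ (e j) (p' i) : ℂ) • (e j : H) := fun i => by
      have := congrArg (Subtype.val) (e.sum_repr' (p' i))
      simpa [p'] using this.symm
    calc ∑ i, p i ⊗ₜ[ℂ] q i
        = ∑ i, ∑ j, (e j : H) ⊗ₜ[ℂ] ((inner ℂ (e j) (p' i) : ℂ) • q i) := by
          refine Finset.sum_congr rfl fun i _ => ?_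
          conv_lhs => rw [hp i]
          rw [TensorProduct.sum_tmul]
          exact Finset.sum_congr rfl fun j _ => TensorProduct.smul_tmul _ _ _
      _ = _ := by
          rw [Finset.sum_comm]
          refine Finset.sum_congr rfl fun j _ => ?_
          rw [← TensorProduct.tmul_sum]
          congr 1
          change _ = bar (b (e j))
          rw [hb]
          have : ∀ f : Fin k → H, bar (∑ i, f i) = ∑ i, bar (f i) := fun f => rfl
          rw [this]
          refine Finset.sum_congr rfl fun i _ => ?_
          rw [← inner_conj_symm (p' i) (e j), ← smul_bar, Equiv.apply_symm_apply]

/-- A polar decomposition of a tensor in `H ⊗ H̄`: it is of the form `∑ sᵢ aᵢ ⊗ b̄ᵢ`, with positive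
parts `∑ sᵢ aᵢ ⊗ āᵢ` and `∑ sᵢ bᵢ ⊗ b̄ᵢ` of no larger norm. -/
theorem exists_polar_decomposition [CompleteSpace H] (ξ : H ⊗[ℂ] ConjSpace H) :
    ∃ (n : ℕ) (a b : Fin n → H) (s : Fin n → ℝ), (∀ i, 0 ≤ s i) ∧
      ξ = ∑ i, ((s i : ℂ) • a i) ⊗ₜ[ℂ] bar (b i) ∧
      ‖∑ i, ((s i : ℂ) • a i) ⊗ₜ[ℂ] bar (a i)‖ ≤ ‖ξ‖ ∧
      ‖∑ i, ((s i : ℂ) • b i) ⊗ₜ[ℂ] bar (b i)‖ ≤ ‖ξ‖ := by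
  obtain ⟨n, a, b, ha, hb, hξ⟩ := exists_orthogonal_decomposition ξ
  -- The normalisation of `b i`, and `0` when `b i = 0`, because `0⁻¹ = 0`.
  let c : Fin n → H := fun i => ((‖b i‖⁻¹ : ℝ) : ℂ) • b i
  have hbc : ∀ i, b i = (‖b i‖ : ℂ) • c i := fun i => by
    by_cases h : b i = 0
    · simp [c, h]
    · have : (‖b i‖ : ℂ) ≠ 0 := by exact_mod_cast norm_ne_zero_iff.mpr h
      simp [c, smul_smul, this]
  have hc : ∀ i, ‖b i‖ * ‖c i‖ = ‖b i‖ := fun i => by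
    conv_rhs => rw [hbc i, norm_smul]
    simp
  have hcc : ∀ i j, i ≠ j → inner ℂ (c i) (c j) = 0 := fun i j hij => by
    simp [c, hb i j hij]
  have hξ' : ξ = ∑ i, ((‖b i‖ : ℂ) • a i) ⊗ₜ[ℂ] bar (c i) := by
    rw [hξ]
    refine Finset.sum_congr rfl fun i _ => ?_
    conv_lhs => rw [hbc i]
    rw [TensorProduct.smul_tmul, smul_bar, Complex.conj_ofReal]
  have hnorm : ‖ξ‖ ^ 2 = ∑ i, ‖b i‖ ^ 2 := by
    rw [hξ, norm_sq_sum_tmul_bar a b fun i j hij => by rw [ha.inner_eq_zero hij, zero_mul]]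
    simp [ha.norm_eq_one]
  refine ⟨n, a, c, fun i => ‖b i‖, fun i => norm_nonneg _, hξ', ?_, ?_⟩
  · refine (sq_le_sq₀ (norm_nonneg _) (norm_nonneg _)).mp ?_
    rw [hnorm, norm_sq_sum_tmul_bar _ a fun i j hij => by
      rw [ha.inner_eq_zero hij.symm, mul_zero]]
    simp [ha.norm_eq_one, norm_smul]
  · refine (sq_le_sq₀ (norm_nonneg _) (norm_nonneg _)).mp ?_
    rw [hnorm, norm_sq_sum_tmul_bar _ c fun i j hij => by
      rw [hcc j i hij.symm, mul_zero]]
    refine (Finset.sum_congr rfl fun i _ => ?_).le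
    rw [norm_smul, Complex.norm_real, norm_norm, hc, hc]

end ConjSpace

/-! ### The minimal norm on positive tensors -/

section MinNorm

variable {E H : Type*} [NormedAddCommGroup E] [NormedSpace ℂ E]
  [NormedAddCommGroup H] [InnerProductSpace ℂ H]

open ConjSpace

theorem spatialMap_sumTmulBar (ι : E →ₗᵢ[ℂ] (H →L[ℂ] H)) {n : ℕ} (x : Fin n → E) :
    spatialMap ι (conjEmbedding ι) (sumTmulBar x) =
      ∑ i, TensorProduct.mapL (ι (x i)) (op (ι (x i))) := by
  rw [sumTmulBar, map_sum]
  rfl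

theorem minNorm_nonneg (ι : E →ₗᵢ[ℂ] (H →L[ℂ] H)) (w : E ⊗[ℂ] ConjSpace E) :
    0 ≤ minNorm ι (conjEmbedding ι) w :=
  ContinuousLinearMap.opNorm_nonneg _

/-- For `b = a` and `d = c` every term is a weight times a squared modulus. Positivity and
Cauchy–Schwarz are both read off from this expansion. -/
theorem inner_sum_mapL_op {n k l : ℕ} (A : Fin n → H →L[ℂ] H) (a b : Fin k → H) (s : Fin k → ℝ)
    (c d : Fin l → H) (t : Fin l → ℝ) :
    inner ℂ (∑ j, ((t j : ℂ) • c j) ⊗ₜ[ℂ] bar (d j))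
        ((∑ m, TensorProduct.mapL (A m) (op (A m))) (∑ i, ((s i : ℂ) • a i) ⊗ₜ[ℂ] bar (b i))) =
      ∑ p : Fin n × Fin k × Fin l, ((s p.2.1 * t p.2.2 : ℝ) : ℂ) *
        (inner ℂ (c p.2.2) (A p.1 (a p.2.1)) *
          starRingEnd ℂ (inner ℂ (d p.2.2) (A p.1 (b p.2.1)))) := by
  rw [Fintype.sum_prod_type]
  simp_rw [Fintype.sum_prod_type]
  rw [sum_apply, inner_sum]
  refine Finset.sum_congr rfl fun m _ => ?_
  rw [map_sum, inner_sum]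
  refine Finset.sum_congr rfl fun i _ => ?_
  rw [sum_inner]
  refine Finset.sum_congr rfl fun j _ => ?_
  rw [TensorProduct.mapL_tmul, op_apply, Equiv.symm_apply_apply, inner_tmul_bar, map_smul,
    inner_smul_left, inner_smul_right, inner_conj_symm, Complex.conj_ofReal, Complex.ofReal_mul]
  ring

theorem re_inner_sum_mapL_op_nonneg {n k l : ℕ} (A : Fin n → H →L[ℂ] H)
    (a : Fin k → H) {s : Fin k → ℝ} (hs : ∀ i, 0 ≤ s i)
    (c : Fin l → H) {t : Fin l → ℝ} (ht : ∀ i, 0 ≤ t i) :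
    0 ≤ (inner ℂ (∑ j, ((t j : ℂ) • c j) ⊗ₜ[ℂ] bar (c j))
      ((∑ m, TensorProduct.mapL (A m) (op (A m)))
        (∑ i, ((s i : ℂ) • a i) ⊗ₜ[ℂ] bar (a i)))).re := by
  rw [inner_sum_mapL_op, Complex.re_sum]
  refine Finset.sum_nonneg fun p _ => ?_
  rw [Complex.mul_conj, ← Complex.ofReal_mul, Complex.ofReal_re]
  exact mul_nonneg (mul_nonneg (hs _) (ht _)) (Complex.normSq_nonneg _)

/-- Cauchy--Schwarz for the positive map `∑ Aᵢ ⊗ Āᵢ`. -/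
theorem norm_inner_sum_mapL_op_sq_le {n k l : ℕ} (A : Fin n → H →L[ℂ] H)
    (a b : Fin k → H) {s : Fin k → ℝ} (hs : ∀ i, 0 ≤ s i)
    (c d : Fin l → H) {t : Fin l → ℝ} (ht : ∀ i, 0 ≤ t i) :
    ‖inner ℂ (∑ j, ((t j : ℂ) • c j) ⊗ₜ[ℂ] bar (d j))
      ((∑ m, TensorProduct.mapL (A m) (op (A m)))
        (∑ i, ((s i : ℂ) • a i) ⊗ₜ[ℂ] bar (b i)))‖ ^ 2 ≤
    (inner ℂ (∑ j, ((t j : ℂ) • c j) ⊗ₜ[ℂ] bar (c j))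
      ((∑ m, TensorProduct.mapL (A m) (op (A m)))
        (∑ i, ((s i : ℂ) • a i) ⊗ₜ[ℂ] bar (a i)))).re *
    (inner ℂ (∑ j, ((t j : ℂ) • d j) ⊗ₜ[ℂ] bar (d j))
      ((∑ m, TensorProduct.mapL (A m) (op (A m)))
        (∑ i, ((s i : ℂ) • b i) ⊗ₜ[ℂ] bar (b i)))).re := by
  simp_rw [inner_sum_mapL_op, Complex.re_sum, Complex.mul_conj, ← Complex.ofReal_mul,
    Complex.ofReal_re]
  have hnn : ∀ p : Fin n × Fin k × Fin l, 0 ≤ s p.2.1 * t p.2.2 := fun p =>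
    mul_nonneg (hs _) (ht _)
  refine le_trans (pow_le_pow_left₀ (norm_nonneg _) (norm_sum_le _ _) 2) ?_
  refine Finset.sum_sq_le_sum_mul_sum_of_sq_le_mul _
    (fun p _ => mul_nonneg (hnn p) (Complex.normSq_nonneg _))
    (fun p _ => mul_nonneg (hnn p) (Complex.normSq_nonneg _)) fun p _ => le_of_eq ?_
  rw [norm_mul, norm_mul, RCLike.norm_conj, Complex.norm_real, Real.norm_of_nonneg (hnn p),
    Complex.normSq_eq_norm_sq, Complex.normSq_eq_norm_sq]
  ring

theorem opNorm_le_of_norm_inner_le {V : Type*} [NormedAddCommGroup V] [InnerProductSpace ℂ V]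
    (T : V →L[ℂ] V) {M : ℝ} (hM : 0 ≤ M) (h : ∀ ξ η, ‖inner ℂ η (T ξ)‖ ≤ M * ‖ξ‖ * ‖η‖) :
    ‖T‖ ≤ M := by
  refine ContinuousLinearMap.opNorm_le_bound _ hM fun ξ => ?_
  have h1 := h ξ (T ξ)
  rw [inner_self_eq_norm_sq_to_K, norm_pow, RCLike.norm_ofReal, abs_norm, sq] at h1
  by_cases h0 : ‖T ξ‖ = 0
  · rw [h0]; positivity
  · exact le_of_mul_le_mul_right h1 (lt_of_le_of_ne (norm_nonneg _) (Ne.symm h0))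

/-- The norm of `∑ Aᵢ ⊗ Āᵢ` is determined by its values on positive tensors. -/
theorem norm_sum_mapL_op_le [CompleteSpace H] {n : ℕ} (A : Fin n → H →L[ℂ] H) {M : ℝ} (hM : 0 ≤ M)
    (h : ∀ (k l : ℕ) (a : Fin k → H) (s : Fin k → ℝ) (c : Fin l → H) (t : Fin l → ℝ),
      (∀ i, 0 ≤ s i) → (∀ j, 0 ≤ t j) →
      (inner ℂ (∑ j, ((t j : ℂ) • c j) ⊗ₜ[ℂ] bar (c j))
        ((∑ m, TensorProduct.mapL (A m) (op (A m)))
          (∑ i, ((s i : ℂ) • a i) ⊗ₜ[ℂ] bar (a i)))).re ≤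
        M * ‖∑ i, ((s i : ℂ) • a i) ⊗ₜ[ℂ] bar (a i)‖ *
          ‖∑ j, ((t j : ℂ) • c j) ⊗ₜ[ℂ] bar (c j)‖) :
    ‖∑ m, TensorProduct.mapL (A m) (op (A m))‖ ≤ M := by
  have key : ∀ ξ η : H ⊗[ℂ] ConjSpace H,
      ‖inner ℂ η ((∑ m, TensorProduct.mapL (A m) (op (A m))) ξ)‖ ≤ M * ‖ξ‖ * ‖η‖ := by
    intro ξ η
    -- Cauchy–Schwarz bounds the squared pairing by a product of two pairings of positive parts,
    -- whose norms do not exceed those of `ξ` and `η`.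
    obtain ⟨k, a, b, s, hs, hξ, hξa, hξb⟩ := exists_polar_decomposition ξ
    obtain ⟨l, c, d, t, ht, hη, hηc, hηd⟩ := exists_polar_decomposition η
    refine abs_le_of_sq_le_sq' ?_ (by positivity) |>.2
    have hle := norm_inner_sum_mapL_op_sq_le A a b hs c d ht
    rw [← hξ, ← hη] at hle
    refine hle.trans ?_
    rw [sq]
    refine mul_le_mul ((h k l a s c t hs ht).trans ?_) ((h k l b s d t hs ht).trans ?_)
      (re_inner_sum_mapL_op_nonneg A b hs d ht) (by positivity)
    all_goals gcongr
  exact opNorm_le_of_norm_inner_le _ hM key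

/-- The minimal norm is monotone on positive tensors. -/
theorem minNorm_le_minNorm_add [CompleteSpace H] (ι : E →ₗᵢ[ℂ] (H →L[ℂ] H)) {n m : ℕ}
    (x : Fin n → E) (y : Fin m → E) :
    minNorm ι (conjEmbedding ι) (sumTmulBar x) ≤
      minNorm ι (conjEmbedding ι) (sumTmulBar x + sumTmulBar y) := by
  unfold minNorm
  rw [map_add]
  simp_rw [spatialMap_sumTmulBar]
  refine norm_sum_mapL_op_le _ (ContinuousLinearMap.opNorm_nonneg _) fun k l a s c t hs ht => ?_
  -- On positive test tensors the `y` part contributes a nonnegative amount, so it can be dropped.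
  have h0 := re_inner_sum_mapL_op_nonneg (fun i => ι (y i)) a hs c ht
  have h1 := (Complex.re_le_norm _).trans (norm_inner_le_norm (𝕜 := ℂ)
    (∑ j, ((t j : ℂ) • c j) ⊗ₜ[ℂ] bar (c j))
    ((∑ i, TensorProduct.mapL (ι (x i)) (op (ι (x i))) +
      ∑ i, TensorProduct.mapL (ι (y i)) (op (ι (y i))))
        (∑ i, ((s i : ℂ) • a i) ⊗ₜ[ℂ] bar (a i))))
  have h2 := mul_le_mul_of_nonneg_left (ContinuousLinearMap.le_opNorm
    (∑ i, TensorProduct.mapL (ι (x i)) (op (ι (x i))) +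
      ∑ i, TensorProduct.mapL (ι (y i)) (op (ι (y i))))
    (∑ i, ((s i : ℂ) • a i) ⊗ₜ[ℂ] bar (a i)))
    (norm_nonneg (∑ j, ((t j : ℂ) • c j) ⊗ₜ[ℂ] bar (c j)))
  have h3 := h1.trans h2
  rw [add_apply, inner_add_right, Complex.add_re] at h3
  linarith

/-- Both sides are norms of the very same operator on `H ⊗ H̄`. -/
theorem minNorm_comp_subtype (ι : E →ₗᵢ[ℂ] (H →L[ℂ] H)) (F : Submodule ℂ E) {n : ℕ}
    (x : Fin n → F) :
    minNorm (ι.comp F.subtypeₗᵢ) (conjEmbedding (ι.comp F.subtypeₗᵢ)) (sumTmulBar x) =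
      minNorm ι (conjEmbedding ι) (sumTmulBar fun i => (x i : E)) := by
  unfold minNorm
  rw [spatialMap_sumTmulBar, spatialMap_sumTmulBar]
  rfl

theorem minNorm_tmul_bar_le (ι : E →ₗᵢ[ℂ] (H →L[ℂ] H)) (x : E) :
    minNorm ι (conjEmbedding ι) (x ⊗ₜ[ℂ] bar x) ≤ ‖x‖ ^ 2 := by
  refine (TensorProduct.norm_mapL_le (ι x) (op (ι x))).trans ?_
  rw [norm_op, ι.norm_map, sq]

theorem minNorm_add_le (ι : E →ₗᵢ[ℂ] (H →L[ℂ] H)) (v w : E ⊗[ℂ] ConjSpace E) :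
    minNorm ι (conjEmbedding ι) (v + w) ≤
      minNorm ι (conjEmbedding ι) v + minNorm ι (conjEmbedding ι) w := by
  unfold minNorm
  rw [map_add]
  exact ContinuousLinearMap.opNorm_add_le _ _

theorem opNorm_smul {V : Type*} [NormedAddCommGroup V] [NormedSpace ℂ V] (c : ℂ) (T : V →L[ℂ] V) :
    ‖c • T‖ = ‖c‖ * ‖T‖ := norm_smul c T

theorem minNorm_smul (ι : E →ₗᵢ[ℂ] (H →L[ℂ] H)) (c : ℂ) (w : E ⊗[ℂ] ConjSpace E) :
    minNorm ι (conjEmbedding ι) (c • w) = ‖c‖ * minNorm ι (conjEmbedding ι) w := by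
  unfold minNorm
  rw [map_smul]
  exact opNorm_smul c _

theorem sumTmulBar_append {n m : ℕ} (x : Fin n → E) (y : Fin m → E) :
    sumTmulBar (Fin.append x y) = sumTmulBar x + sumTmulBar y := by
  simp [sumTmulBar, Fin.sum_univ_add]

theorem sumTmulBar_smul {n : ℕ} (c : ℂ) (x : Fin n → E) :
    sumTmulBar (fun i => c • x i) = ((‖c‖ ^ 2 : ℝ) : ℂ) • sumTmulBar x := by
  rw [sumTmulBar, sumTmulBar, Finset.smul_sum]
  refine Finset.sum_congr rfl fun i _ => ?_
  have h : bar (c • x i) = (starRingEnd ℂ c) • bar (x i) := by rw [smul_bar, Complex.conj_conj]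
  rw [h, TensorProduct.tmul_smul, ← TensorProduct.smul_tmul', smul_smul, mul_comm,
    Complex.mul_conj, Complex.normSq_eq_norm_sq]

theorem IsPositiveTensor.add {v w : E ⊗[ℂ] ConjSpace E} (hv : IsPositiveTensor v)
    (hw : IsPositiveTensor w) : IsPositiveTensor (v + w) := by
  obtain ⟨n, x, rfl⟩ := hv
  obtain ⟨m, y, rfl⟩ := hw
  exact ⟨n + m, Fin.append x y, (sumTmulBar_append x y).symm⟩

theorem sumTmulBar_sqrt_smul {n : ℕ} {c : ℝ} (hc : 0 ≤ c) (x : Fin n → E) :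
    sumTmulBar (fun i => (Real.sqrt c : ℂ) • x i) = (c : ℂ) • sumTmulBar x := by
  rw [sumTmulBar_smul, Complex.norm_real, Real.norm_of_nonneg (Real.sqrt_nonneg c),
    Real.sq_sqrt hc]

theorem IsPositiveTensor.smul {w : E ⊗[ℂ] ConjSpace E} (hw : IsPositiveTensor w) {c : ℝ}
    (hc : 0 ≤ c) : IsPositiveTensor ((c : ℂ) • w) := by
  obtain ⟨n, x, rfl⟩ := hw
  exact ⟨n, _, (sumTmulBar_sqrt_smul hc x).symm⟩

theorem isPositiveTensor_tmul_bar (x : E) : IsPositiveTensor (x ⊗ₜ[ℂ] bar x) :=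
  ⟨1, fun _ => x, by simp [sumTmulBar]⟩

theorem isPositiveTensor_zero : IsPositiveTensor (0 : E ⊗[ℂ] ConjSpace E) :=
  ⟨0, Fin.elim0, by simp [sumTmulBar]⟩

end MinNorm

/-! ### A sandwich form of Hahn–Banach -/

section Sandwich

variable {V : Type*} [AddCommGroup V] [Module ℂ V]

/-- A sandwich form of the Hahn--Banach theorem: a convex cone of lower bounds that is compatible
with a sublinear functional is respected by a linear form below the functional. -/
theorem exists_linearMap_re_le_of_cone_le {N : V → ℝ}
    (N_hom : ∀ c : ℝ, 0 < c → ∀ v, N ((c : ℂ) • v) = c * N v)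
    (N_add : ∀ v w, N (v + w) ≤ N v + N w) {S : Set (V × ℝ)} (S_zero : (0, 0) ∈ S)
    (S_add : ∀ p ∈ S, ∀ q ∈ S, p + q ∈ S)
    (S_smul : ∀ c : ℝ, 0 < c → ∀ p ∈ S, ((c : ℂ) • p.1, c * p.2) ∈ S)
    (hS : ∀ p ∈ S, p.2 ≤ N p.1) :
    ∃ g : V →ₗ[ℂ] ℂ, (∀ v, (g v).re ≤ N v) ∧ ∀ p ∈ S, p.2 ≤ (g p.1).re := by
  -- A real linear form below this sublinear functional does both jobs: `q = 0` gives the bound by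
  -- `N`, and evaluation at `-p.1` with `q = p` gives the lower bound on the cone.
  let P : V → ℝ := fun w => sInf ((fun q : V × ℝ => N (w + q.1) - q.2) '' S)
  have hbdd : ∀ w, BddBelow ((fun q : V × ℝ => N (w + q.1) - q.2) '' S) := by
    intro w
    refine ⟨-N (-w), ?_⟩
    rintro _ ⟨q, hq, rfl⟩
    have h1 := N_add (-w) (w + q.1)
    rw [neg_add_cancel_left] at h1
    have h2 := hS q hq
    change -N (-w) ≤ N (w + q.1) - q.2
    linarith
  have hne : ∀ w, ((fun q : V × ℝ => N (w + q.1) - q.2) '' S).Nonempty := fun w =>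
    Set.Nonempty.image _ ⟨_, S_zero⟩
  have hP_le : ∀ w, ∀ q ∈ S, P w ≤ N (w + q.1) - q.2 := fun w q hq =>
    csInf_le (hbdd w) ⟨q, hq, rfl⟩
  have hP_smul_le : ∀ c : ℝ, 0 < c → ∀ w, P ((c : ℂ) • w) ≤ c * P w := by
    intro c hc w
    rw [← div_le_iff₀' hc]
    refine le_csInf (hne w) ?_
    rintro _ ⟨q, hq, rfl⟩
    rw [div_le_iff₀' hc]
    refine (hP_le _ _ (S_smul c hc q hq)).trans ?_
    change N ((c : ℂ) • w + (c : ℂ) • q.1) - c * q.2 ≤ c * (N (w + q.1) - q.2)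
    rw [← smul_add, N_hom c hc, mul_sub]
  have hP_smul : ∀ c : ℝ, 0 < c → ∀ w, P (c • w) = c * P w := by
    intro c hc w
    refine le_antisymm (hP_smul_le c hc w) ?_
    have h := hP_smul_le c⁻¹ (inv_pos.mpr hc) ((c : ℂ) • w)
    rw [smul_smul, ← Complex.ofReal_mul, inv_mul_cancel₀ hc.ne', Complex.ofReal_one, one_smul,
      ← div_eq_inv_mul, le_div_iff₀' hc] at h
    exact h
  have hP_add : ∀ v w, P (v + w) ≤ P v + P w := by
    intro v w
    rw [← sub_le_iff_le_add]
    refine le_csInf (hne v) ?_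
    rintro _ ⟨q, hq, rfl⟩
    rw [sub_le_comm]
    refine le_csInf (hne w) ?_
    rintro _ ⟨r, hr, rfl⟩
    have h1 := hP_le (v + w) _ (S_add q hq r hr)
    have h2 := N_add (v + q.1) (w + r.1)
    rw [add_add_add_comm] at h2
    simp only [Prod.fst_add, Prod.snd_add] at h1
    change P (v + w) - (N (v + q.1) - q.2) ≤ N (w + r.1) - r.2
    linarith
  have hP_zero : P 0 = 0 := by
    have h := hP_smul 2 two_pos 0
    rw [smul_zero] at h
    linarith
  obtain ⟨f, -, hf⟩ := exists_extension_of_le_sublinear (E := V) ⊥ P hP_smul hP_add fun x => by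
    have hx : (x : V) = 0 := (Submodule.mem_bot ℝ).mp x.2
    have hx' : x = 0 := Subtype.ext hx
    rw [hx, hP_zero, hx', LinearPMap.map_zero]
  have hN_zero : N 0 = 0 := by
    have h := N_hom 2 two_pos 0
    rw [smul_zero] at h
    linarith
  refine ⟨Module.Dual.extendRCLike f, fun v => ?_, fun p hp => ?_⟩
  · have h := (hf v).trans (hP_le v _ S_zero)
    rw [add_zero, sub_zero] at h
    exact (Module.Dual.re_extendRCLike_apply (𝕜 := ℂ) f v).trans_le h
  · have h := (hf (-p.1)).trans (hP_le (-p.1) p hp)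
    rw [neg_add_cancel, hN_zero, map_neg] at h
    have h' : (Module.Dual.extendRCLike (𝕜 := ℂ) f p.1).re = f p.1 :=
      Module.Dual.re_extendRCLike_apply (𝕜 := ℂ) f p.1
    linarith

end Sandwich

/-! ### Positive forms and domination -/

section Forms

variable {E H Y : Type*} [NormedAddCommGroup E] [NormedSpace ℂ E]
  [NormedAddCommGroup H] [InnerProductSpace ℂ H] [NormedAddCommGroup Y] [NormedSpace ℂ Y]

open ConjSpace

/-- The hermitian part `x ⊗ ȳ ↦ (g (x ⊗ ȳ) + conj (g (y ⊗ x̄))) / 2` of a linear form `g`. -/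
noncomputable def hermitianPart (g : E ⊗[ℂ] ConjSpace E →ₗ[ℂ] ℂ) : E ⊗[ℂ] ConjSpace E →ₗ[ℂ] ℂ :=
  TensorProduct.lift (LinearMap.mk₂ ℂ
    (fun x y => (g (x ⊗ₜ[ℂ] y) + starRingEnd ℂ (g (bar.symm y ⊗ₜ[ℂ] bar x))) / 2)
    (fun x x' y => by
      rw [bar_add, TensorProduct.tmul_add, TensorProduct.add_tmul, map_add, map_add, map_add]
      ring)
    (fun c x y => by
      have h : bar (c • x) = starRingEnd ℂ c • bar x := by rw [smul_bar, Complex.conj_conj]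
      rw [h, TensorProduct.tmul_smul, ← TensorProduct.smul_tmul', map_smul, map_smul,
        smul_eq_mul, smul_eq_mul, smul_eq_mul, map_mul, Complex.conj_conj]
      ring)
    (fun x y y' => by
      rw [bar_symm_add, TensorProduct.tmul_add, TensorProduct.add_tmul, map_add, map_add, map_add]
      ring)
    (fun c x y => by
      rw [bar_symm_smul, TensorProduct.tmul_smul, ← TensorProduct.smul_tmul', map_smul, map_smul,
        smul_eq_mul, smul_eq_mul, smul_eq_mul, map_mul, Complex.conj_conj]
      ring))

theorem hermitianPart_tmul_bar (g : E ⊗[ℂ] ConjSpace E →ₗ[ℂ] ℂ) (x y : E) :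
    hermitianPart g (x ⊗ₜ[ℂ] bar y) =
      (g (x ⊗ₜ[ℂ] bar y) + starRingEnd ℂ (g (y ⊗ₜ[ℂ] bar x))) / 2 := rfl

theorem conj_hermitianPart_tmul_bar (g : E ⊗[ℂ] ConjSpace E →ₗ[ℂ] ℂ) (x y : E) :
    starRingEnd ℂ (hermitianPart g (x ⊗ₜ[ℂ] bar y)) = hermitianPart g (y ⊗ₜ[ℂ] bar x) := by
  rw [hermitianPart_tmul_bar, hermitianPart_tmul_bar, map_div₀, map_add, Complex.conj_conj,
    add_comm, Complex.conj_ofNat]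

theorem hermitianPart_tmul_bar_self (g : E ⊗[ℂ] ConjSpace E →ₗ[ℂ] ℂ) (x : E) :
    hermitianPart g (x ⊗ₜ[ℂ] bar x) = ((g (x ⊗ₜ[ℂ] bar x)).re : ℂ) := by
  rw [hermitianPart_tmul_bar, Complex.add_conj]
  simp

/-- Passing to the hermitian part makes the values on `x ⊗ x̄` real without disturbing any estimate
on positive tensors. -/
theorem hermitianPart_re_of_isPositiveTensor (g : E ⊗[ℂ] ConjSpace E →ₗ[ℂ] ℂ)
    {w : E ⊗[ℂ] ConjSpace E} (hw : IsPositiveTensor w) :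
    (hermitianPart g w).re = (g w).re := by
  obtain ⟨n, x, rfl⟩ := hw
  simp [sumTmulBar, hermitianPart_tmul_bar_self]

theorem re_le_minNorm_of_mem_formsK {ι : E →ₗᵢ[ℂ] (H →L[ℂ] H)}
    {φ : E ⊗[ℂ] ConjSpace E →ₗ[ℂ] ℂ} (hφ : φ ∈ formsK ι) {w : E ⊗[ℂ] ConjSpace E}
    (hw : IsPositiveTensor w) : (φ w).re ≤ minNorm ι (conjEmbedding ι) w := by
  -- Normalising by `r` above the norm, not by the norm itself, covers tensors of norm zero.
  refine le_of_forall_gt_imp_ge_of_dense fun r hr => ?_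
  have hr0 : 0 < r := (minNorm_nonneg ι w).trans_lt hr
  have h := hφ.2 _ (hw.smul (inv_nonneg.mpr hr0.le)) (by
    rw [minNorm_smul, Complex.norm_real, Real.norm_of_nonneg (inv_nonneg.mpr hr0.le),
      inv_mul_le_iff₀ hr0, mul_one]
    exact hr.le)
  rwa [map_smul, smul_eq_mul, Complex.re_ofReal_mul, inv_mul_le_iff₀ hr0, mul_one] at h

/-- The infimum is attained: the inequality holds for every `r > C` and is continuous in `r`. -/
theorem isTwoOHSumming_and_pi2oh_le_iff {ι : E →ₗᵢ[ℂ] (H →L[ℂ] H)} {u : E →L[ℂ] Y} {C : ℝ}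
    (hC : 0 ≤ C) : IsTwoOHSumming ι u ∧ pi2oh ι u ≤ C ↔ IsTwoOHBound ι u C := by
  have hbdd : BddBelow {C : ℝ | 0 ≤ C ∧ IsTwoOHBound ι u C} := ⟨0, fun _ h => h.1⟩
  constructor
  · rintro ⟨⟨D, hD⟩, hle⟩ n x
    have hne : {C : ℝ | 0 ≤ C ∧ IsTwoOHBound ι u C}.Nonempty :=
      -- The constant `D` may be negative, but only its square matters.
      ⟨|D|, abs_nonneg D, fun n x => by rw [sq_abs]; exact hD n x⟩
    have hm := minNorm_nonneg ι (sumTmulBar x)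
    have hev : ∀ r : ℝ, C < r →
        ∑ i, ‖u (x i)‖ ^ 2 ≤ r ^ 2 * minNorm ι (conjEmbedding ι) (sumTmulBar x) := by
      intro r hr
      obtain ⟨c, ⟨hc0, hc⟩, hcr⟩ := (csInf_lt_iff hbdd hne).mp (hle.trans_lt hr)
      refine (hc n x).trans ?_
      gcongr
    have hcont : ContinuousWithinAt
        (fun r : ℝ => r ^ 2 * minNorm ι (conjEmbedding ι) (sumTmulBar x)) (Set.Ioi C) C := by
      fun_prop
    refine ge_of_tendsto hcont ?_
    filter_upwards [self_mem_nhdsWithin] with r hr using hev r hr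
  · intro h
    exact ⟨⟨C, h⟩, csInf_le hbdd ⟨hC, h⟩⟩

theorem zero_mem_formsK (ι : E →ₗᵢ[ℂ] (H →L[ℂ] H)) : (0 : E ⊗[ℂ] ConjSpace E →ₗ[ℂ] ℂ) ∈ formsK ι :=
  ⟨fun _ => le_rfl, fun _ _ _ => zero_le_one⟩

/-- The domination theorem for `(2,oh)`-summing operators on a subspace. -/
theorem exists_mem_formsK_of_isTwoOHBound [CompleteSpace H] (ι : E →ₗᵢ[ℂ] (H →L[ℂ] H))
    (F : Submodule ℂ E) (u : F →L[ℂ] Y) {C : ℝ} (hu : IsTwoOHBound (ι.comp F.subtypeₗᵢ) u C) :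
    ∃ φ ∈ formsK ι, ∀ x : F,
      ‖u x‖ ^ 2 ≤ C ^ 2 * (φ ((x : E) ⊗ₜ[ℂ] ConjSpace.bar (x : E))).re := by
  -- For `C = 0` the operator `u` vanishes and `φ = 0` works; otherwise division by `C ^ 2` is
  -- allowed.
  rcases eq_or_ne C 0 with rfl | hC
  · refine ⟨0, zero_mem_formsK ι, fun x => ?_⟩
    simpa using hu 1 fun _ => x
  have hC2 : 0 < C ^ 2 := by positivity
  -- The lower bounds demanded of the form: tensors from `F` encode domination of `u`, and the
  -- summand `b` encodes positivity on all of `E`. Compatibility with the norm is the summing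
  -- inequality plus monotonicity.
  let S : Set ((E ⊗[ℂ] ConjSpace E) × ℝ) :=
    {p | ∃ (n : ℕ) (y : Fin n → F) (b : E ⊗[ℂ] ConjSpace E), IsPositiveTensor b ∧
      p.1 = sumTmulBar (fun i => (y i : E)) + b ∧ C ^ 2 * p.2 = ∑ i, ‖u (y i)‖ ^ 2}
  obtain ⟨g, hgN, hgS⟩ := exists_linearMap_re_le_of_cone_le
    (N := minNorm ι (conjEmbedding ι)) (S := S)
    (fun c hc v => by rw [minNorm_smul, Complex.norm_real, Real.norm_of_nonneg hc.le])
    (minNorm_add_le ι)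
    ⟨0, Fin.elim0, 0, isPositiveTensor_zero, by simp [sumTmulBar], by simp⟩
    (by
      rintro p ⟨n, y, b, hb, hp, hp'⟩ q ⟨m, z, c, hc, hq, hq'⟩
      refine ⟨n + m, Fin.append y z, b + c, hb.add hc, ?_, ?_⟩
      · have happ : (fun i => ((Fin.append y z i : F) : E)) =
            Fin.append (fun i => (y i : E)) fun i => (z i : E) := by
          ext i
          refine Fin.addCases (fun j => ?_) (fun j => ?_) i <;> simp
        rw [Prod.fst_add, hp, hq, happ, sumTmulBar_append, add_add_add_comm]
      · rw [Prod.snd_add, mul_add, hp', hq', Fin.sum_univ_add]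
        simp)
    (by
      rintro c hc p ⟨n, y, b, hb, hp, hp'⟩
      refine ⟨n, fun i => (Real.sqrt c : ℂ) • y i, (c : ℂ) • b, hb.smul hc.le, ?_, ?_⟩
      · change (c : ℂ) • p.1 = _
        rw [hp, smul_add, ← sumTmulBar_sqrt_smul hc.le]
        rfl
      · change C ^ 2 * (c * p.2) = _
        rw [mul_left_comm, hp', Finset.mul_sum]
        refine Finset.sum_congr rfl fun i _ => ?_
        rw [map_smul, norm_smul, mul_pow, Complex.norm_real,
          Real.norm_of_nonneg (Real.sqrt_nonneg c), Real.sq_sqrt hc.le])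
    (by
      rintro p ⟨n, y, _, ⟨m, z, rfl⟩, hp, hp'⟩
      refine le_of_mul_le_mul_left ?_ hC2
      rw [hp', hp]
      refine (hu n y).trans ?_
      rw [minNorm_comp_subtype]
      exact mul_le_mul_of_nonneg_left (minNorm_le_minNorm_add ι _ z) hC2.le)
  refine ⟨hermitianPart g, ⟨fun x => ?_, fun w hw hw1 => ?_⟩, fun x => ?_⟩
  · rw [hermitianPart_tmul_bar_self, Complex.zero_le_real]
    exact hgS (x ⊗ₜ[ℂ] bar x, 0)
      ⟨0, Fin.elim0, _, isPositiveTensor_tmul_bar x, by simp [sumTmulBar], by simp⟩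
  · rw [hermitianPart_re_of_isPositiveTensor g hw]
    exact (hgN w).trans hw1
  · rw [hermitianPart_tmul_bar_self, Complex.ofReal_re, ← div_le_iff₀' hC2]
    refine hgS ((x : E) ⊗ₜ[ℂ] bar (x : E), ‖u x‖ ^ 2 / C ^ 2)
      ⟨1, fun _ => x, 0, isPositiveTensor_zero, by simp [sumTmulBar], ?_⟩
    rw [mul_div_cancel₀ _ hC2.ne']
    simp

end Forms

/-! ### Extension through a Hilbert space -/

/-- An operator on a subspace that is dominated by a Hilbert space valued map extends to the whole
space with the same domination. -/
theorem exists_extension_of_norm_le {E K Y : Type*} [AddCommGroup E] [Module ℂ E]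
    [NormedAddCommGroup K] [InnerProductSpace ℂ K] [CompleteSpace K]
    [NormedAddCommGroup Y] [NormedSpace ℂ Y] [CompleteSpace Y] (J : E →ₗ[ℂ] K)
    (F : Submodule ℂ E) (u : F →ₗ[ℂ] Y) {C : ℝ} (hC : 0 ≤ C) (h : ∀ x : F, ‖u x‖ ≤ C * ‖J x‖) :
    ∃ v : E →ₗ[ℂ] Y, (∀ x : F, v x = u x) ∧ ∀ x, ‖v x‖ ≤ C * ‖J x‖ := by
  let M : Submodule ℂ K := (F.map J).topologicalClosure
  have : CompleteSpace M := (F.map J).isClosed_topologicalClosure.completeSpace_coe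
  let e : F →ₗ[ℂ] M := (J.comp F.subtype).codRestrict M fun x =>
    (F.map J).le_topologicalClosure ⟨x, x.2, rfl⟩
  have hrange : (Subtype.val '' Set.range e : Set K) = F.map J := by
    ext k
    constructor
    · rintro ⟨_, ⟨x, rfl⟩, rfl⟩
      exact ⟨x, x.2, rfl⟩
    · rintro ⟨x, hx, rfl⟩
      exact ⟨_, ⟨⟨x, hx⟩, rfl⟩, rfl⟩
  have hdense : DenseRange e := by
    refine Subtype.dense_iff.mpr ?_
    change (M : Set K) ⊆ closure (Subtype.val '' Set.range e : Set K)
    rw [hrange]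
    exact subset_rfl
  have hnorm : ∀ x : F, ‖u x‖ ≤ C * ‖e x‖ := h
  -- By `hnorm`, `u` factors through its dense image in `M` and extends by continuity; the
  -- projection onto `M` has norm at most one, so `C` survives.
  let L : M →L[ℂ] Y := u.extendOfNorm e
  refine ⟨L.toLinearMap ∘ₗ M.orthogonalProjectionOnto.toLinearMap ∘ₗ J, fun x => ?_, fun x => ?_⟩
  · have hx : M.orthogonalProjectionOnto (J x) = e x :=
      Submodule.orthogonalProjectionOnto_mem_subspace_eq_self (e x)
    change L (M.orthogonalProjectionOnto (J x)) = u x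
    rw [hx]
    exact LinearMap.extendOfNorm_eq hdense ⟨C, hnorm⟩ x
  · refine (LinearMap.norm_extendOfNorm_apply_le hdense C hnorm _).trans ?_
    exact mul_le_mul_of_nonneg_left (Submodule.norm_orthogonalProjectionOnto_apply_le M (J x)) hC

universe u

/-- A positive semidefinite hermitian form is the pull-back of an inner product. -/
theorem PreInnerProductSpace.Core.exists_linearMap_norm_sq {E : Type u} [AddCommGroup E]
    [Module ℂ E] (c : PreInnerProductSpace.Core ℂ E) :
    ∃ (K : Type u) (_ : NormedAddCommGroup K) (_ : InnerProductSpace ℂ K) (_ : CompleteSpace K)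
      (J : E →ₗ[ℂ] K), ∀ x, ‖J x‖ ^ 2 = (c.inner x x).re := by
  let : SeminormedAddCommGroup E := InnerProductSpace.Core.toSeminormedAddCommGroup (𝕜 := ℂ)
  let : InnerProductSpace ℂ E := InnerProductSpace.ofCore c
  -- The completion is Hausdorff, so null vectors are identified with zero without a separate
  -- quotient.
  refine ⟨UniformSpace.Completion E, inferInstance, inferInstance, inferInstance,
    (UniformSpace.Completion.toComplL (𝕜 := ℂ) (E := E)).toLinearMap, fun x => ?_⟩
  have h : ‖(x : UniformSpace.Completion E)‖ ^ 2 = ‖x‖ ^ 2 := by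
    rw [UniformSpace.Completion.norm_coe]
  exact h.trans (norm_sq_eq_re_inner (𝕜 := ℂ) x)

section Extension

variable {E H Y : Type*} [NormedAddCommGroup E] [NormedSpace ℂ E]
  [NormedAddCommGroup H] [InnerProductSpace ℂ H] [NormedAddCommGroup Y] [NormedSpace ℂ Y]

open ConjSpace

/-- The semi-inner product `⟪x, y⟫ = φ (y ⊗ x̄)` defined by the hermitian part of a positive form. -/
@[reducible]
noncomputable def IsPositiveForm.toCore {φ : E ⊗[ℂ] ConjSpace E →ₗ[ℂ] ℂ} (hφ : IsPositiveForm φ) :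
    PreInnerProductSpace.Core ℂ E where
  inner x y := hermitianPart φ (y ⊗ₜ[ℂ] bar x)
  conj_inner_symm x y := conj_hermitianPart_tmul_bar φ x y
  re_inner_nonneg x := by
    rw [hermitianPart_tmul_bar_self]
    exact (Complex.nonneg_iff.mp (hφ x)).1
  add_left x y z := by rw [bar_add, TensorProduct.tmul_add, map_add]
  smul_left x y c := by
    have h : bar (c • x) = starRingEnd ℂ c • bar x := by rw [smul_bar, Complex.conj_conj]
    rw [h, TensorProduct.tmul_smul, map_smul, smul_eq_mul]

theorem exists_extension_isTwoOHBound_of_mem_formsK [CompleteSpace Y] {ι : E →ₗᵢ[ℂ] (H →L[ℂ] H)}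
    (F : Submodule ℂ E) (u : F →L[ℂ] Y) {C : ℝ} (hC : 0 ≤ C) {φ : E ⊗[ℂ] ConjSpace E →ₗ[ℂ] ℂ}
    (hφ : φ ∈ formsK ι) (hu : ∀ x : F, ‖u x‖ ^ 2 ≤ C ^ 2 * (φ ((x : E) ⊗ₜ[ℂ] bar (x : E))).re) :
    ∃ v : E →L[ℂ] Y, (∀ x : F, v x = u x) ∧ IsTwoOHBound ι v C := by
  obtain ⟨K, _, _, _, J, hJ'⟩ := hφ.1.toCore.exists_linearMap_norm_sq
  have hJ : ∀ x, ‖J x‖ ^ 2 = (φ (x ⊗ₜ[ℂ] bar x)).re := fun x => by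
    rw [hJ', ← hermitianPart_re_of_isPositiveTensor φ (isPositiveTensor_tmul_bar x)]
    rfl
  obtain ⟨v, hvu, hv⟩ := exists_extension_of_norm_le J F u.toLinearMap hC fun x =>
    (sq_le_sq₀ (norm_nonneg _) (mul_nonneg hC (norm_nonneg _))).mp (by
      rw [mul_pow, hJ]
      exact hu x)
  -- This makes the extension bounded for the norm of `E`.
  have hJx : ∀ x, ‖J x‖ ≤ ‖x‖ := fun x =>
    (sq_le_sq₀ (norm_nonneg _) (norm_nonneg _)).mp (by
      rw [hJ]
      exact (re_le_minNorm_of_mem_formsK hφ (isPositiveTensor_tmul_bar x)).trans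
        (minNorm_tmul_bar_le ι x))
  refine ⟨v.mkContinuous C fun x => (hv x).trans (mul_le_mul_of_nonneg_left (hJx x) hC), hvu,
    fun n x => ?_⟩
  calc ∑ i, ‖v (x i)‖ ^ 2 ≤ ∑ i, C ^ 2 * (φ (x i ⊗ₜ[ℂ] bar (x i))).re := by
        refine Finset.sum_le_sum fun i _ => ?_
        rw [← hJ, ← mul_pow]
        exact pow_le_pow_left₀ (norm_nonneg _) (hv (x i)) 2
    _ = C ^ 2 * (φ (sumTmulBar x)).re := by
        rw [sumTmulBar, map_sum, Complex.re_sum, Finset.mul_sum]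
    _ ≤ _ := mul_le_mul_of_nonneg_left (re_le_minNorm_of_mem_formsK hφ ⟨n, x, rfl⟩) (sq_nonneg C)

theorem IsTwoOHBound.comp_subtype {ι : E →ₗᵢ[ℂ] (H →L[ℂ] H)} {v : E →L[ℂ] Y} {C : ℝ}
    (hv : IsTwoOHBound ι v C) {F : Submodule ℂ E} {u : F →L[ℂ] Y} (huv : ∀ x : F, v x = u x) :
    IsTwoOHBound (ι.comp F.subtypeₗᵢ) u C := fun n x => by
  rw [minNorm_comp_subtype]
  simp_rw [← huv]
  exact hv n fun i => (x i : E)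

end Extension

theorem proposition1 {E H Y : Type*}
    [NormedAddCommGroup H] [InnerProductSpace ℂ H] [CompleteSpace H]
    [NormedAddCommGroup E] [NormedSpace ℂ E] [CompleteSpace E]
    [NormedAddCommGroup Y] [NormedSpace ℂ Y] [CompleteSpace Y]
    (ι : E →ₗᵢ[ℂ] (H →L[ℂ] H))
    (F : Submodule ℂ E) (hF : IsClosed (F : Set E))
    (u : F →L[ℂ] Y) (C : ℝ) (hC : 0 ≤ C) :
    List.TFAE
      [IsTwoOHSumming (ι.comp F.subtypeₗᵢ) u ∧ pi2oh (ι.comp F.subtypeₗᵢ) u ≤ C,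
       ∃ φ ∈ formsK ι, ∀ x : F,
        ‖u x‖ ^ 2 ≤ C ^ 2 * (φ ((x : E) ⊗ₜ[ℂ] ConjSpace.bar (x : E))).re,
       ∃ v : E →L[ℂ] Y, (∀ x : F, v x = u x) ∧ IsTwoOHSumming ι v ∧ pi2oh ι v ≤ C] := by
  simp_rw [isTwoOHSumming_and_pi2oh_le_iff hC]
  tfae_have 1 → 2 := exists_mem_formsK_of_isTwoOHBound ι F u
  tfae_have 2 → 3 := fun ⟨_, hφ, hu⟩ =>
    exists_extension_isTwoOHBound_of_mem_formsK F u hC hφ hu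
  tfae_have 3 → 1 := fun ⟨_, hvu, hv⟩ => hv.comp_subtype hvu
  tfae_finish
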